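/- Throughout, $\|\cdot\|$ is the Euclidean norm of a vector and the spectral norm of a matrix. Let $n,k\ge 1$, let $A\in\mathbb{R}^{n\times n}$ be symmetric with largest and smallest eigenvalues $\lambda_{\max},\lambda_{\min}$, and let $\epsilon_{\mathrm{mach}}\ge 0$. Suppose that $Q\in\mathbb{R}^{n\times k}$ (with first column $q_1$) and the symmetric tridiagonal matrix $T\in\mathbb{R}^{k\times k}$ satisfy the bounds that Paige's theorem gives for the output of $k$ iterations of the Lanczos algorithm run at machine precision $\epsilon_{\mathrm{mach}}$. Of these bounds only the following two are needed: (a) the perturbed Lanczos relation $AQ=QT+\beta\,q\,e_k^{T}+E$ for some $\beta\in\mathbb{R}$, $q\in\mathbb{R}^n$ and error matrix $E\in\mathbb{R}^{n\times k}$; (b) every eigenvalue of $T$ lies in $[\lambda_{\min}-\epsilon_1,\ \lambda_{\max}+\epsilon_1]$, where $\epsilon_1=k^{5/2}\|A\|(68+17n^{3/2})\,\epsilon_{\mathrm{mach}}$. Let $\eta>0$ satisfy $\eta\ge 85\,n^{3/2}k^{5/2}\|A\|\,\epsilon_{\mathrm{mach}}$. Then: (1) For every $C$ and every real polynomial $p$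 of degree less than $k$ with $|p(x)|\le C$ for all $x\in[\lambda_{\min}-\eta,\lambda_{\max}+\eta]$, $$\|Q\,p(T)\,e_1-p(A)\,q_1\|\le\frac{2Ck^3\|E\|}{\eta}.$$ (2) For every integer $0\le i<k$, $$\|Q\,\overline{T}_i(T)\,e_1-\overline{T}_i(A)\,q_1\|\le\frac{2i^2\|E\|}{\eta},$$ where $\overline{T}_i(x)=T_i\big(\delta(x-r_{\min})-1\big)$, $T_i$ is the Chebyshev polynomial of the first kind of degree $i$, $r_{\min}=\lambda_{\min}-\eta$, $r_{\max}=\lambda_{\max}+\eta$ and $\delta=2/(r_{\max}-r_{\min})$. -/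

import Mathlib

open scoped Matrix Matrix.Norms.L2Operator
-- From here on the norm of a real matrix is its spectral norm (Euclidean operator norm).

namespace Lanczos

/-- Largest eigenvalue of a real symmetric matrix. -/
noncomputable def lambdaMax {n : ℕ} (A : Matrix (Fin n) (Fin n) ℝ) : ℝ :=
  sSup (spectrum ℝ A)

/-- Smallest eigenvalue of a real symmetric matrix. -/
noncomputable def lambdaMin {n : ℕ} (A : Matrix (Fin n) (Fin n) ℝ) : ℝ :=
  sInf (spectrum ℝ A)

/-- For a nonempty real symmetric matrix, `lambdaMax` is the greatest eigenvalue. -/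
theorem isGreatest_lambdaMax {n : ℕ} (hn : 0 < n) {A : Matrix (Fin n) (Fin n) ℝ}
    (hA : A.IsSymm) : IsGreatest (spectrum ℝ A) (lambdaMax A) := by
  have hH : A.IsHermitian := by
    rw [Matrix.IsHermitian, Matrix.conjTranspose_eq_transpose_of_trivial]; exact hA
  have hs := hH.spectrum_real_eq_range_eigenvalues
  have : Nonempty (Fin n) := ⟨⟨0, hn⟩⟩
  have hfin : (spectrum ℝ A).Finite := hs ▸ Set.finite_range _
  have hne : (spectrum ℝ A).Nonempty := hs ▸ Set.range_nonempty _
  exact ⟨hne.csSup_mem hfin, fun x hx => le_csSup hfin.bddAbove hx⟩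

/-- For a nonempty real symmetric matrix, `lambdaMin` is the least eigenvalue. -/
theorem isLeast_lambdaMin {n : ℕ} (hn : 0 < n) {A : Matrix (Fin n) (Fin n) ℝ}
    (hA : A.IsSymm) : IsLeast (spectrum ℝ A) (lambdaMin A) := by
  have hH : A.IsHermitian := by
    rw [Matrix.IsHermitian, Matrix.conjTranspose_eq_transpose_of_trivial]; exact hA
  have hs := hH.spectrum_real_eq_range_eigenvalues
  have : Nonempty (Fin n) := ⟨⟨0, hn⟩⟩
  have hfin : (spectrum ℝ A).Finite := hs ▸ Set.finite_range _
  have hne : (spectrum ℝ A).Nonempty := hs ▸ Set.range_nonempty _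
  exact ⟨hne.csInf_mem hfin, fun x hx => csInf_le hfin.bddBelow hx⟩

/-- All entries at distance at least two from the diagonal vanish. -/
def IsTridiagonal {k : ℕ} (T : Matrix (Fin k) (Fin k) ℝ) : Prop :=
  ∀ i j : Fin k, (i : ℕ) + 1 < (j : ℕ) ∨ (j : ℕ) + 1 < (i : ℕ) → T i j = 0

/-- The first standard basis vector of `ℝ^k`. -/
def eFirst {k : ℕ} (hk : 0 < k) : Fin k → ℝ := Pi.single ⟨0, hk⟩ 1

/-- The last standard basis vector of `ℝ^k`. -/
def eLast {k : ℕ} (hk : 0 < k) : Fin k → ℝ := Pi.single ⟨k - 1, Nat.sub_lt hk Nat.one_pos⟩ 1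

/-- The Chebyshev polynomial of the first kind of degree `i`, stretched and shifted from
`[-1, 1]` to `[a, b]`: `x ↦ T_i (δ (x - a) - 1)` with `δ = 2 / (b - a)`. -/
noncomputable def shiftedChebyshev (a b : ℝ) (i : ℕ) : Polynomial ℝ :=
  (Polynomial.Chebyshev.T ℝ (i : ℤ)).comp
    (Polynomial.C (2 / (b - a)) * (Polynomial.X - Polynomial.C a) - 1)

/-- The Euclidean norm of `Q p(T) e₁ - p(A) q₁`, where `q₁` is the first column of `Q`. -/
noncomputable def polyError {n k : ℕ} (hk : 0 < k) (A : Matrix (Fin n) (Fin n) ℝ)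
    (Q : Matrix (Fin n) (Fin k) ℝ) (T : Matrix (Fin k) (Fin k) ℝ) (p : Polynomial ℝ) : ℝ :=
  ‖WithLp.toLp 2
    (Q *ᵥ (Polynomial.aeval T p *ᵥ eFirst hk) - Polynomial.aeval A p *ᵥ Q.col ⟨0, hk⟩)‖

end Lanczos

/-!
The error is controlled through Chebyshev polynomials. An affine change of variable takes
`[λ_min - η, λ_max + η]` to `[-1, 1]`; let `B` and `S` be the images of `A` and `T` under it, both
with spectrum in `[-1, 1]`, and let `R = Q S - B Q` be the residual. Because of the three-term
recurrence, the matrices `D i = Q T_i(S) - T_i(B) Q` satisfy the Chebyshev recurrence of `B` with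
forcing term `2 R T_{i+1}(S)`, so that (`mul_aeval_T_sub`)
`D i = U_{i-1}(B) R + 2 ∑_{j<i} U_{i-2-j}(B) R T_{j+1}(S)`.

Applied to `e₁`, the rank-one part of the residual disappears: `T` being tridiagonal, `T_j(S) e₁` has
zero last entry as long as `j + 1 < k` (`IsTridiagonal.aeval_mulVec_eFirst`). What is left is
`R T_j(S) e₁ = -δ E T_j(S) e₁`, of norm at most `δ ‖E‖` since `|T_j| ≤ 1` on `[-1, 1]`
(`norm_residual_mulVec_le`). As `|U_{j-1}| ≤ j` there, summation gives `‖D i e₁‖ ≤ δ i² ‖E‖`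
(`polyError_shiftedChebyshev_le`), and `δ ≤ 1 / η`.

A general polynomial bounded by `C` is a combination of Chebyshev polynomials whose coefficients are
at most `2 C`, by orthogonality (`exists_chebyshev_expansion`), and the errors add up.
-/

namespace Lanczos

open Polynomial Polynomial.Chebyshev

/-! ### Chebyshev polynomials on `[-1, 1]` -/

theorem abs_eval_U_sub_one_le (n : ℕ) {x : ℝ} (hx : |x| ≤ 1) :
    |(U ℝ ((n : ℤ) - 1)).eval x| ≤ n := by
  induction n with
  | zero => simp
  | succ n ih =>
    have h : U ℝ (((n + 1 : ℕ) : ℤ) - 1) = X * U ℝ ((n : ℤ) - 1) + T ℝ n := by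
      have := U_eq_X_mul_U_add_T ℝ ((n : ℤ) - 1)
      rw [sub_add_cancel] at this
      simpa using this
    rw [h, eval_add, eval_mul, eval_X]
    calc |x * (U ℝ ((n : ℤ) - 1)).eval x + (T ℝ n).eval x|
        ≤ |x| * |(U ℝ ((n : ℤ) - 1)).eval x| + |(T ℝ n).eval x| :=
          (abs_add_le _ _).trans_eq (by rw [abs_mul])
      _ ≤ 1 * n + 1 := by
          gcongr
          exact abs_eval_T_real_le_one n hx
      _ = ((n + 1 : ℕ) : ℝ) := by push_cast; ring

/-- The bound on the coefficients is the Fourier one: by orthogonality the integral of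
`p (cos θ) * cos (i θ)` over `[0, π]` is `π * c 0` if `i = 0` and `π / 2 * c i` otherwise. -/
theorem exists_chebyshev_expansion {k : ℕ} {p : ℝ[X]} (hp : p.degree < (k : WithBot ℕ)) {C : ℝ}
    (hC : ∀ x ∈ Set.Icc (-1 : ℝ) 1, |p.eval x| ≤ C) :
    ∃ c : ℕ → ℝ, p = ∑ i ∈ Finset.range k, c i • T ℝ (i : ℤ) ∧
      ∀ i ∈ Finset.range k, |c i| ≤ 2 * C := by
  have hC0 : 0 ≤ C := (abs_nonneg _).trans (hC 0 (by norm_num))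
  have hmem := mem_degreeLT.mpr hp
  rw [← Sequence.span_degreeLT (chebyshevTsequence ℝ) (by simp),
    show Set.Iio k = Finset.range k by simp,
    Submodule.mem_span_image_finset_iff_exists_fun'] at hmem
  obtain ⟨c, hc⟩ := hmem
  replace hc : p = ∑ i ∈ Finset.range k, c i • T ℝ (i : ℤ) := hc.symm
  refine ⟨c, hc, fun i hi => ?_⟩
  have hle : |∫ x, p.eval x * (T ℝ (i : ℤ)).eval x ∂measureT| ≤ C * Real.pi := by
    rw [integral_measureT_eq_integral_cos]
    have h := intervalIntegral.norm_integral_le_of_norm_le_const (a := 0) (b := Real.pi) (C := C)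
      (f := fun θ => p.eval (Real.cos θ) * (T ℝ (i : ℤ)).eval (Real.cos θ)) fun θ _ => by
        rw [norm_mul, Real.norm_eq_abs, Real.norm_eq_abs]
        have h1 := hC _ ⟨Real.neg_one_le_cos θ, Real.cos_le_one θ⟩
        have h2 := abs_eval_T_real_le_one i (Real.abs_cos_le_one θ)
        calc _ ≤ C * 1 := mul_le_mul h1 h2 (abs_nonneg _) hC0
          _ = C := mul_one C
    rwa [sub_zero, abs_of_pos Real.pi_pos, Real.norm_eq_abs] at h
  have hint : ∫ x, p.eval x * (T ℝ (i : ℤ)).eval x ∂measureT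
      = c i * ∫ x, (T ℝ (i : ℤ)).eval x * (T ℝ (i : ℤ)).eval x ∂measureT := by
    have h : ∀ x, p.eval x * (T ℝ (i : ℤ)).eval x
        = ∑ j ∈ Finset.range k, c j * ((T ℝ (j : ℤ)).eval x * (T ℝ (i : ℤ)).eval x) := fun x => by
      rw [hc]
      simp [eval_finsetSum, Finset.sum_mul, mul_assoc]
    simp_rw [h]
    rw [MeasureTheory.integral_finsetSum _ fun j _ => integrable_measureT (by fun_prop)]
    simp_rw [MeasureTheory.integral_const_mul]
    refine Finset.sum_eq_single_of_mem i hi fun j _ hji => ?_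
    rw [integral_eval_T_real_mul_eval_T_real_measureT_of_ne hji, mul_zero]
  have hsq : Real.pi / 2 ≤ ∫ x, (T ℝ (i : ℤ)).eval x * (T ℝ (i : ℤ)).eval x ∂measureT := by
    rcases eq_or_ne i 0 with rfl | h0
    · rw [Nat.cast_zero, integral_eval_T_real_mul_self_measureT_zero]
      linarith [Real.pi_pos]
    · rw [integral_T_real_mul_self_measureT_of_ne_zero h0]
  have hpi := Real.pi_pos
  rw [hint, abs_mul, abs_of_pos ((half_pos hpi).trans_le hsq)] at hle
  have := (mul_le_mul_of_nonneg_left hsq (abs_nonneg (c i))).trans hle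
  nlinarith

/-! ### Spectral norm estimates -/

theorem norm_mulVec_le {m l : ℕ} (M : Matrix (Fin m) (Fin l) ℝ) (v : Fin l → ℝ) :
    ‖WithLp.toLp 2 (M *ᵥ v)‖ ≤ ‖M‖ * ‖WithLp.toLp 2 v‖ :=
  M.l2_opNorm_mulVec (WithLp.toLp 2 v)

theorem isSelfAdjoint_of_isSymm {m : ℕ} {M : Matrix (Fin m) (Fin m) ℝ} (hM : M.IsSymm) :
    IsSelfAdjoint M := by
  rwa [isSelfAdjoint_iff, Matrix.star_eq_conjTranspose,
    Matrix.conjTranspose_eq_transpose_of_trivial]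

theorem isSymm_aeval {m : ℕ} {M : Matrix (Fin m) (Fin m) ℝ} (hM : M.IsSymm) (p : ℝ[X]) :
    (aeval M p).IsSymm := by
  rw [Matrix.IsSymm, aeval_eq_sum_range, Matrix.transpose_sum]
  exact Finset.sum_congr rfl fun i _ => by rw [Matrix.transpose_smul, Matrix.transpose_pow, hM.eq]

theorem spectrum_aeval {m : ℕ} {M : Matrix (Fin m) (Fin m) ℝ} (hM : M.IsSymm) (p : ℝ[X]) :
    spectrum ℝ (aeval M p) = (fun x => p.eval x) '' spectrum ℝ M := by
  rw [← cfc_polynomial p M (isSelfAdjoint_of_isSymm hM)]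
  exact cfc_map_spectrum _ M (isSelfAdjoint_of_isSymm hM)

theorem norm_aeval_le {m : ℕ} {M : Matrix (Fin m) (Fin m) ℝ} (hM : M.IsSymm) (p : ℝ[X]) {c : ℝ}
    (hc : 0 ≤ c) (h : ∀ x ∈ spectrum ℝ M, |p.eval x| ≤ c) : ‖aeval M p‖ ≤ c := by
  rw [← cfc_polynomial p M (isSelfAdjoint_of_isSymm hM)]
  exact norm_cfc_le hc h

theorem norm_eFirst {k : ℕ} (hk : 0 < k) : ‖WithLp.toLp 2 (eFirst hk)‖ = 1 := by
  simp [eFirst]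

theorem mulVec_eFirst {m k : ℕ} (hk : 0 < k) (Q : Matrix (Fin m) (Fin k) ℝ) :
    Q *ᵥ eFirst hk = Q.col ⟨0, hk⟩ :=
  Matrix.mulVec_single_one _ _

/-! ### Krylov vectors of a tridiagonal matrix -/

/-- Multiplication by a tridiagonal matrix extends the support of a vector by at most one index. -/
theorem IsTridiagonal.pow_mulVec_eFirst {k : ℕ} (hk : 0 < k) {T : Matrix (Fin k) (Fin k) ℝ}
    (hT : IsTridiagonal T) (m : ℕ) (l : Fin k) (hl : m < l) : (T ^ m *ᵥ eFirst hk) l = 0 := by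
  induction m generalizing l with
  | zero =>
    rw [pow_zero, Matrix.one_mulVec, eFirst, Pi.single_eq_of_ne]
    rintro rfl
    exact absurd hl (lt_irrefl _)
  | succ m ih =>
    rw [pow_succ', ← Matrix.mulVec_mulVec, Matrix.mulVec, dotProduct]
    refine Finset.sum_eq_zero fun j _ => ?_
    rcases lt_or_ge m j with h | h
    · rw [ih j h, mul_zero]
    · rw [hT l j (Or.inr (by omega)), zero_mul]

theorem IsTridiagonal.aeval_mulVec_eFirst {k : ℕ} (hk : 0 < k) {T : Matrix (Fin k) (Fin k) ℝ}
    (hT : IsTridiagonal T) (p : ℝ[X]) (l : Fin k) (hl : p.natDegree < l) :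
    (aeval T p *ᵥ eFirst hk) l = 0 := by
  rw [aeval_eq_sum_range, Matrix.sum_mulVec, Finset.sum_apply]
  refine Finset.sum_eq_zero fun m hm => ?_
  rw [Matrix.smul_mulVec, Pi.smul_apply,
    hT.pow_mulVec_eFirst hk m l (by have := Finset.mem_range.mp hm; omega), smul_zero]

/-! ### Propagation of the residual through the Chebyshev recurrence -/

/-- The matrices `D i = Q T_i(S) - T_i(B) Q` satisfy the Chebyshev recurrence of `B` with forcing
term `2 R T_{i+1}(S)`, where `R = Q S - B Q`. This is its solution by variation of constants;
the summand `j = i - 1` is zero, since `U_{-1} = 0`. -/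
theorem mul_aeval_T_sub {m l : ℕ} (B : Matrix (Fin m) (Fin m) ℝ) (S : Matrix (Fin l) (Fin l) ℝ)
    (Q : Matrix (Fin m) (Fin l) ℝ) (i : ℕ) :
    Q * aeval S (T ℝ (i : ℤ)) - aeval B (T ℝ (i : ℤ)) * Q
      = aeval B (U ℝ ((i : ℤ) - 1)) * (Q * S - B * Q)
        + (2 : ℝ) • ∑ j ∈ Finset.range i,
          aeval B (U ℝ ((i : ℤ) - 2 - j)) * ((Q * S - B * Q) * aeval S (T ℝ ((j : ℤ) + 1))) := by
  set R := Q * S - B * Q with hR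
  have aevalT {n : ℕ} (M : Matrix (Fin n) (Fin n) ℝ) (i : ℤ) :
      aeval M (T ℝ (i + 2)) = (2 : ℝ) • (M * aeval M (T ℝ (i + 1))) - aeval M (T ℝ i) := by
    rw [T_add_two, map_sub, map_mul, map_mul, aeval_X, map_ofNat, two_smul, mul_assoc, two_mul]
  have aevalU (i : ℤ) :
      aeval B (U ℝ (i + 2)) = (2 : ℝ) • (B * aeval B (U ℝ (i + 1))) - aeval B (U ℝ i) := by
    rw [U_add_two, map_sub, map_mul, map_mul, aeval_X, map_ofNat, two_smul, mul_assoc, two_mul]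
  induction i using Nat.twoStepInduction with
  | zero => simp
  | one => simp [hR]
  | more i ih0 ih1 =>
    have hQS : Q * S = R + B * Q := by rw [hR, sub_add_cancel]
    -- the inhomogeneous recurrence `D (i + 2) = 2 B D (i + 1) - D i + 2 R T_{i+1}(S)`
    have hrec : Q * aeval S (T ℝ ((i + 2 : ℕ) : ℤ)) - aeval B (T ℝ ((i + 2 : ℕ) : ℤ)) * Q
        = (2 : ℝ) • (B * (Q * aeval S (T ℝ ((i + 1 : ℕ) : ℤ))
            - aeval B (T ℝ ((i + 1 : ℕ) : ℤ)) * Q))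
          - (Q * aeval S (T ℝ (i : ℤ)) - aeval B (T ℝ (i : ℤ)) * Q)
          + (2 : ℝ) • (R * aeval S (T ℝ ((i : ℤ) + 1))) := by
      push_cast
      rw [aevalT S, aevalT B, Matrix.mul_sub, Matrix.sub_mul, Matrix.mul_smul, ← Matrix.mul_assoc Q,
        hQS, Matrix.smul_mul, Matrix.add_mul, Matrix.mul_sub, Matrix.mul_assoc B,
        Matrix.mul_assoc B]
      module
    rw [hrec, ih0, ih1]
    have hi1 : ((i + 1 : ℕ) : ℤ) - 1 = ((i : ℤ) - 1) + 1 := by push_cast; ring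
    have hi2 : ((i + 2 : ℕ) : ℤ) - 1 = ((i : ℤ) - 1) + 2 := by push_cast; ring
    have hterm (j : ℕ) : aeval B (U ℝ (((i + 2 : ℕ) : ℤ) - 2 - j))
        = (2 : ℝ) • (B * aeval B (U ℝ (((i + 1 : ℕ) : ℤ) - 2 - j)))
          - aeval B (U ℝ ((i : ℤ) - 2 - j)) := by
      rw [show ((i + 2 : ℕ) : ℤ) - 2 - j = ((i : ℤ) - 2 - j) + 2 by push_cast; ring, aevalU,
        show ((i + 1 : ℕ) : ℤ) - 2 - j = ((i : ℤ) - 2 - j) + 1 by push_cast; ring]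
    -- the recurrence for `U` holds termwise up to `j = i`, where `U_{-2} = -1` yields the forcing
    -- term, while the summand `j = i + 1` is zero
    have h1 : aeval B (U ℝ (((i + 2 : ℕ) : ℤ) - 2 - ((i + 1 : ℕ) : ℤ))) = 0 := by
      rw [show ((i + 2 : ℕ) : ℤ) - 2 - ((i + 1 : ℕ) : ℤ) = -1 by push_cast; ring]
      simp
    have h2 : aeval B (U ℝ ((i : ℤ) - 2 - i)) = -1 := by
      rw [show (i : ℤ) - 2 - i = -2 by ring]
      simp
    have h3 := Finset.sum_range_succ (fun j : ℕ =>
      aeval B (U ℝ ((i : ℤ) - 2 - j)) * (R * aeval S (T ℝ ((j : ℤ) + 1)))) i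
    rw [h2, Matrix.neg_mul, Matrix.one_mul, ← sub_eq_add_neg] at h3
    rw [Finset.sum_range_succ _ (i + 1), h1, Matrix.zero_mul, add_zero, hi1, hi2, aevalU]
    simp_rw [hterm, Matrix.sub_mul, Finset.sum_sub_distrib, Matrix.smul_mul, Matrix.mul_assoc B]
    rw [h3, ← Finset.smul_sum, ← Matrix.mul_sum, Matrix.mul_add, Matrix.mul_smul]
    module

/-- If the residual `Q S - B Q` maps each `T_j(S) v` with `j < i` to a vector of norm at most `r`,
then the error grows at most like `i ^ 2`, because `|U_{j-1}| ≤ j` on `[-1, 1]` and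
`i + 2 * ∑_{j<i} j = i ^ 2`. -/
theorem norm_mul_aeval_T_sub_mulVec_le {m l : ℕ} {B : Matrix (Fin m) (Fin m) ℝ} (hB : B.IsSymm)
    (hBs : ∀ x ∈ spectrum ℝ B, |x| ≤ 1) (S : Matrix (Fin l) (Fin l) ℝ)
    (Q : Matrix (Fin m) (Fin l) ℝ) (v : Fin l → ℝ) {r : ℝ} (i : ℕ)
    (hr : ∀ j < i, ‖WithLp.toLp 2 ((Q * S - B * Q) *ᵥ (aeval S (T ℝ (j : ℤ)) *ᵥ v))‖ ≤ r) :
    ‖WithLp.toLp 2 ((Q * aeval S (T ℝ (i : ℤ)) - aeval B (T ℝ (i : ℤ)) * Q) *ᵥ v)‖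
      ≤ (i : ℝ) ^ 2 * r := by
  rcases Nat.eq_zero_or_pos i with rfl | hi
  · simp
  have hU (n : ℕ) (w : Fin m → ℝ) (hw : ‖WithLp.toLp 2 w‖ ≤ r) :
      ‖WithLp.toLp 2 (aeval B (U ℝ ((n : ℤ) - 1)) *ᵥ w)‖ ≤ n * r :=
    (norm_mulVec_le _ _).trans (mul_le_mul
      (norm_aeval_le hB _ n.cast_nonneg fun x hx => abs_eval_U_sub_one_le n (hBs x hx)) hw
      (norm_nonneg _) n.cast_nonneg)
  have hterm : ∀ j ∈ Finset.range i, ‖WithLp.toLp 2 (aeval B (U ℝ ((i : ℤ) - 2 - j)) *ᵥ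
      ((Q * S - B * Q) *ᵥ (aeval S (T ℝ ((j : ℤ) + 1)) *ᵥ v)))‖ ≤ ((i - 1 - j : ℕ) : ℝ) * r := by
    intro j hj
    rw [Finset.mem_range] at hj
    rw [show (i : ℤ) - 2 - j = ((i - 1 - j : ℕ) : ℤ) - 1 by omega]
    rcases Nat.lt_or_ge (j + 1) i with h | h
    · refine hU _ _ ?_
      exact_mod_cast hr (j + 1) h
    · simp [show i - 1 - j = 0 by omega]
  rw [mul_aeval_T_sub, Matrix.add_mulVec, Matrix.smul_mulVec, Matrix.sum_mulVec]
  simp_rw [← Matrix.mulVec_mulVec]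
  rw [WithLp.toLp_add, WithLp.toLp_smul, WithLp.toLp_sum]
  have hsum : ∑ j ∈ Finset.range i, ((i - 1 - j : ℕ) : ℝ) * 2 = i * (i - 1) := by
    rw [Finset.sum_range_reflect (fun j : ℕ => (j : ℝ) * 2) i, ← Finset.sum_mul]
    have := congrArg (Nat.cast (R := ℝ)) (Finset.sum_range_id_mul_two i)
    push_cast [Nat.cast_sub (show 1 ≤ i from hi)] at this
    exact this
  refine (norm_add_le _ _).trans ?_
  rw [norm_smul, Real.norm_ofNat]
  calc _ ≤ i * r + 2 * ∑ j ∈ Finset.range i, ((i - 1 - j : ℕ) : ℝ) * r := by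
        refine add_le_add (hU i _ ?_) ?_
        · simpa using hr 0 hi
        · gcongr
          exact norm_sum_le_of_le _ hterm
    _ = i * r + (∑ j ∈ Finset.range i, ((i - 1 - j : ℕ) : ℝ) * 2) * r := by
        rw [Finset.mul_sum, Finset.sum_mul]
        congr 1
        exact Finset.sum_congr rfl fun j _ => by ring
    _ = (i : ℝ) ^ 2 * r := by rw [hsum]; ring

/-! ### The error of a Chebyshev polynomial under the perturbed Lanczos relation -/

/-- The affine polynomial mapping `[a, b]` onto `[-1, 1]`. -/
noncomputable def toUnit (a b : ℝ) : ℝ[X] := C (2 / (b - a)) * (X - C a) - 1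

theorem shiftedChebyshev_eq (a b : ℝ) (i : ℕ) :
    shiftedChebyshev a b i = (T ℝ (i : ℤ)).comp (toUnit a b) := rfl

theorem abs_eval_toUnit_le {a b : ℝ} (hab : a < b) {x : ℝ} (hx : x ∈ Set.Icc a b) :
    |(toUnit a b).eval x| ≤ 1 := by
  have h : 0 < b - a := sub_pos.mpr hab
  have he : (toUnit a b).eval x = 2 * ((x - a) / (b - a)) - 1 := by
    simp only [toUnit, eval_sub, eval_mul, eval_C, eval_X, eval_one]
    ring
  have h0 : 0 ≤ (x - a) / (b - a) := div_nonneg (sub_nonneg.mpr hx.1) h.le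
  have h1 : (x - a) / (b - a) ≤ 1 := (div_le_one h).mpr (by linarith [hx.2])
  rw [he, abs_le]
  constructor <;> linarith

theorem abs_le_one_of_mem_spectrum_toUnit {m : ℕ} {M : Matrix (Fin m) (Fin m) ℝ} (hM : M.IsSymm)
    {a b : ℝ} (hab : a < b) (h : ∀ x ∈ spectrum ℝ M, x ∈ Set.Icc a b) :
    ∀ x ∈ spectrum ℝ (aeval M (toUnit a b)), |x| ≤ 1 := by
  rw [spectrum_aeval hM]
  rintro _ ⟨x, hx, rfl⟩
  exact abs_eval_toUnit_le hab (h x hx)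

theorem polyError_eq {n k : ℕ} (hk : 0 < k) (A : Matrix (Fin n) (Fin n) ℝ)
    (Q : Matrix (Fin n) (Fin k) ℝ) (T : Matrix (Fin k) (Fin k) ℝ) (p : ℝ[X]) :
    polyError hk A Q T p = ‖WithLp.toLp 2 ((Q * aeval T p - aeval A p * Q) *ᵥ eFirst hk)‖ := by
  rw [polyError, ← mulVec_eFirst hk Q, Matrix.sub_mulVec, Matrix.mulVec_mulVec,
    Matrix.mulVec_mulVec]

/-- Since `T_j(S) e₁` has zero last entry for `j + 1 < k`, the rank-one term of the Lanczos relation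
drops out and only `E` contributes to the residual. -/
theorem norm_residual_mulVec_le {n k : ℕ} (hk : 0 < k) {A : Matrix (Fin n) (Fin n) ℝ}
    {Q : Matrix (Fin n) (Fin k) ℝ} {T : Matrix (Fin k) (Fin k) ℝ} (hT : T.IsSymm)
    (hTtri : IsTridiagonal T) {β : ℝ} {q : Fin n → ℝ} {E : Matrix (Fin n) (Fin k) ℝ}
    (hrel : A * Q = Q * T + β • Matrix.vecMulVec q (eLast hk) + E) {a b : ℝ} (hab : a < b)
    (hTs : ∀ x ∈ spectrum ℝ T, x ∈ Set.Icc a b) {j : ℕ} (hj : j + 1 < k) :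
    ‖WithLp.toLp 2 ((Q * aeval T (toUnit a b) - aeval A (toUnit a b) * Q) *ᵥ
      (aeval (aeval T (toUnit a b)) (Chebyshev.T ℝ (j : ℤ)) *ᵥ eFirst hk))‖
      ≤ 2 / (b - a) * ‖E‖ := by
  set v := aeval (aeval T (toUnit a b)) (Chebyshev.T ℝ (j : ℤ)) *ᵥ eFirst hk with hv
  have hres : Q * aeval T (toUnit a b) - aeval A (toUnit a b) * Q
      = -((2 / (b - a)) • (β • Matrix.vecMulVec q (eLast hk) + E)) := by
    have h {m : ℕ} (M : Matrix (Fin m) (Fin m) ℝ) : aeval M (toUnit a b)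
        = (2 / (b - a)) • M - (2 / (b - a) * a) • (1 : Matrix (Fin m) (Fin m) ℝ) - 1 := by
      simp only [toUnit, map_sub, map_mul, Polynomial.aeval_C, aeval_X, map_one,
        Algebra.algebraMap_eq_smul_one, smul_mul_assoc, one_mul, smul_sub, smul_smul]
    rw [h, h]
    simp only [Matrix.mul_sub, Matrix.sub_mul, Matrix.mul_smul, Matrix.smul_mul, Matrix.mul_one,
      Matrix.one_mul]
    rw [hrel]
    module
  have hdeg : (toUnit a b).natDegree ≤ 1 := by
    rw [toUnit]
    compute_degree
  have hlast : eLast hk ⬝ᵥ v = 0 := by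
    rw [eLast, single_dotProduct, one_mul, hv, ← aeval_comp]
    refine hTtri.aeval_mulVec_eFirst hk _ _ ?_
    have h1 := natDegree_comp_le (p := Chebyshev.T ℝ (j : ℤ)) (q := toUnit a b)
    rw [natDegree_T, Int.natAbs_natCast] at h1
    have h2 := Nat.mul_le_mul_left j hdeg
    change _ < k - 1
    omega
  have hvn : ‖WithLp.toLp 2 v‖ ≤ 1 := by
    refine (norm_mulVec_le _ _).trans ?_
    rw [norm_eFirst, mul_one]
    exact norm_aeval_le (isSymm_aeval hT _) _ zero_le_one fun x hx => abs_eval_T_real_le_one _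
      (abs_le_one_of_mem_spectrum_toUnit hT hab hTs x hx)
  have hδ : 0 < 2 / (b - a) := div_pos two_pos (sub_pos.mpr hab)
  rw [hres, Matrix.neg_mulVec, Matrix.smul_mulVec, Matrix.add_mulVec, Matrix.smul_mulVec,
    Matrix.vecMulVec_mulVec, hlast, MulOpposite.op_zero, zero_smul, smul_zero, zero_add,
    WithLp.toLp_neg, WithLp.toLp_smul, norm_neg, norm_smul, Real.norm_of_nonneg hδ.le]
  gcongr
  calc _ ≤ ‖E‖ * ‖WithLp.toLp 2 v‖ := norm_mulVec_le _ _
    _ ≤ ‖E‖ * 1 := by gcongr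
    _ = ‖E‖ := mul_one _

theorem polyError_shiftedChebyshev_le {n k : ℕ} (hk : 0 < k) {A : Matrix (Fin n) (Fin n) ℝ}
    (hA : A.IsSymm) {Q : Matrix (Fin n) (Fin k) ℝ} {T : Matrix (Fin k) (Fin k) ℝ} (hT : T.IsSymm)
    (hTtri : IsTridiagonal T) {β : ℝ} {q : Fin n → ℝ} {E : Matrix (Fin n) (Fin k) ℝ}
    (hrel : A * Q = Q * T + β • Matrix.vecMulVec q (eLast hk) + E) {a b : ℝ} (hab : a < b)
    (hAs : ∀ x ∈ spectrum ℝ A, x ∈ Set.Icc a b) (hTs : ∀ x ∈ spectrum ℝ T, x ∈ Set.Icc a b)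
    {i : ℕ} (hi : i < k) :
    polyError hk A Q T (shiftedChebyshev a b i) ≤ (i : ℝ) ^ 2 * (2 / (b - a) * ‖E‖) := by
  rw [polyError_eq, shiftedChebyshev_eq, aeval_comp, aeval_comp]
  exact norm_mul_aeval_T_sub_mulVec_le (isSymm_aeval hA _)
    (abs_le_one_of_mem_spectrum_toUnit hA hab hAs) _ _ _ _ fun j hj =>
      norm_residual_mulVec_le hk hT hTtri hrel hab hTs (by omega)

/-! ### General polynomials -/

theorem polyError_sum_smul_le {n k : ℕ} (hk : 0 < k) (A : Matrix (Fin n) (Fin n) ℝ)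
    (Q : Matrix (Fin n) (Fin k) ℝ) (T : Matrix (Fin k) (Fin k) ℝ) {ι : Type*} (s : Finset ι)
    (c : ι → ℝ) (p : ι → ℝ[X]) :
    polyError hk A Q T (∑ i ∈ s, c i • p i) ≤ ∑ i ∈ s, |c i| * polyError hk A Q T (p i) := by
  simp_rw [polyError_eq, map_sum, map_smul, Matrix.mul_sum, Matrix.sum_mul, Matrix.mul_smul,
    Matrix.smul_mul, ← Finset.sum_sub_distrib, ← smul_sub, Matrix.sum_mulVec, Matrix.smul_mulVec,
    WithLp.toLp_sum, WithLp.toLp_smul]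
  exact norm_sum_le_of_le _ fun i _ => by rw [norm_smul, Real.norm_eq_abs]

/-- The Chebyshev expansion carried over from `[-1, 1]` to `[a, b]`. -/
theorem exists_shiftedChebyshev_expansion {k : ℕ} {p : ℝ[X]} (hp : p.degree < (k : WithBot ℕ))
    {a b : ℝ} (hab : a < b) {K : ℝ} (hK : ∀ x ∈ Set.Icc a b, |p.eval x| ≤ K) :
    ∃ c : ℕ → ℝ, p = ∑ i ∈ Finset.range k, c i • shiftedChebyshev a b i ∧
      ∀ i ∈ Finset.range k, |c i| ≤ 2 * K := by
  have h : b - a ≠ 0 := (sub_pos.mpr hab).ne'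
  -- the inverse of `toUnit a b`
  set w : ℝ[X] := C ((b - a) / 2) * (X + 1) + C a with hw
  have hwdeg : w.natDegree ≤ 1 := by
    rw [hw]
    compute_degree
  have hdeg : (p.comp w).degree < (k : WithBot ℕ) := by
    rcases eq_or_ne p 0 with rfl | hp0
    · simp
    have h1 := natDegree_comp_le (p := p) (q := w)
    have h2 := Nat.mul_le_mul_left p.natDegree hwdeg
    have h3 := (natDegree_lt_iff_degree_lt hp0).mpr hp
    exact degree_le_natDegree.trans_lt (by exact_mod_cast (by omega : (p.comp w).natDegree < k))
  obtain ⟨c, hc, hcK⟩ := exists_chebyshev_expansion hdeg (C := K) fun x hx => by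
    rw [eval_comp]
    refine hK _ ?_
    have := sub_pos.mpr hab
    simp only [hw, eval_add, eval_mul, eval_C, eval_X, eval_one]
    constructor <;> nlinarith [hx.1, hx.2]
  refine ⟨c, ?_, hcK⟩
  have hinv : w.comp (toUnit a b) = X := by
    have : C ((b - a) / 2) * C (2 / (b - a)) = (1 : ℝ[X]) := by
      rw [← Polynomial.C_mul, div_mul_div_cancel₀' h, div_self two_ne_zero, C_1]
    simp only [hw, toUnit, add_comp, mul_comp, C_comp, X_comp, one_comp, sub_add_cancel]
    linear_combination (X - C a) * this
  have := congrArg (fun r => r.comp (toUnit a b)) hc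
  simp only [comp_assoc, hinv, comp_X, Polynomial.sum_comp, smul_comp] at this
  exact this

end Lanczos

theorem mainTheorem2 {n k : ℕ} (hn : 0 < n) (hk : 0 < k)
    (A : Matrix (Fin n) (Fin n) ℝ) (hA : A.IsSymm)
    (Q : Matrix (Fin n) (Fin k) ℝ)
    (T : Matrix (Fin k) (Fin k) ℝ) (hT : T.IsSymm) (hTtri : Lanczos.IsTridiagonal T)
    (β : ℝ) (q : Fin n → ℝ) (E : Matrix (Fin n) (Fin k) ℝ)
    (ε : ℝ) (hε : 0 ≤ ε)
    -- the perturbed Lanczos relation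
    (hrel : A * Q = Q * T + β • Matrix.vecMulVec q (Lanczos.eLast hk) + E)
    -- the bound on the eigenvalues of the computed `T`
    (hspec : ∀ μ ∈ spectrum ℝ T,
      Lanczos.lambdaMin A - (k : ℝ) ^ (5 / 2 : ℝ) * ‖A‖ * (68 + 17 * (n : ℝ) ^ (3 / 2 : ℝ)) * ε ≤ μ ∧
      μ ≤ Lanczos.lambdaMax A + (k : ℝ) ^ (5 / 2 : ℝ) * ‖A‖ * (68 + 17 * (n : ℝ) ^ (3 / 2 : ℝ)) * ε)
    (η : ℝ) (hη : 0 < η)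
    (hηε : 85 * (n : ℝ) ^ (3 / 2 : ℝ) * (k : ℝ) ^ (5 / 2 : ℝ) * ‖A‖ * ε ≤ η) :
    (∀ (C : ℝ) (p : Polynomial ℝ), p.degree < (k : WithBot ℕ) →
      (∀ x ∈ Set.Icc (Lanczos.lambdaMin A - η) (Lanczos.lambdaMax A + η), |p.eval x| ≤ C) →
      Lanczos.polyError hk A Q T p ≤ 2 * C * (k : ℝ) ^ 3 * ‖E‖ / η) ∧
    (∀ i : ℕ, i < k →
      Lanczos.polyError hk A Q T
        (Lanczos.shiftedChebyshev (Lanczos.lambdaMin A - η) (Lanczos.lambdaMax A + η) i)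
        ≤ 2 * (i : ℝ) ^ 2 * ‖E‖ / η) := by
  have hmin := Lanczos.isLeast_lambdaMin hn hA
  have hmax := Lanczos.isGreatest_lambdaMax hn hA
  have hle : Lanczos.lambdaMin A ≤ Lanczos.lambdaMax A := hmin.2 hmax.1
  set a := Lanczos.lambdaMin A - η with ha
  set b := Lanczos.lambdaMax A + η with hb
  have hab : a < b := by linarith
  have hAs : ∀ x ∈ spectrum ℝ A, x ∈ Set.Icc a b := fun x hx =>
    ⟨by linarith [hmin.2 hx], by linarith [hmax.2 hx]⟩
  have hε1 : (k : ℝ) ^ (5 / 2 : ℝ) * ‖A‖ * (68 + 17 * (n : ℝ) ^ (3 / 2 : ℝ)) * ε ≤ η := by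
    have h1 : (1 : ℝ) ≤ (n : ℝ) ^ (3 / 2 : ℝ) :=
      Real.one_le_rpow (by exact_mod_cast hn) (by norm_num)
    calc _ ≤ (k : ℝ) ^ (5 / 2 : ℝ) * ‖A‖ * (85 * (n : ℝ) ^ (3 / 2 : ℝ)) * ε := by
          gcongr
          linarith
      _ = 85 * (n : ℝ) ^ (3 / 2 : ℝ) * (k : ℝ) ^ (5 / 2 : ℝ) * ‖A‖ * ε := by ring
      _ ≤ η := hηε
  have hTs : ∀ x ∈ spectrum ℝ T, x ∈ Set.Icc a b := fun x hx =>
    ⟨by linarith [(hspec x hx).1], by linarith [(hspec x hx).2]⟩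
  have hδ : 2 / (b - a) ≤ 1 / η := by
    rw [div_le_div_iff₀ (sub_pos.mpr hab) hη]
    linarith
  have hcheb : ∀ i : ℕ, i < k →
      Lanczos.polyError hk A Q T (Lanczos.shiftedChebyshev a b i) ≤ (i : ℝ) ^ 2 * ‖E‖ / η := by
    intro i hi
    calc _ ≤ (i : ℝ) ^ 2 * (2 / (b - a) * ‖E‖) :=
          Lanczos.polyError_shiftedChebyshev_le hk hA hT hTtri hrel hab hAs hTs hi
      _ ≤ (i : ℝ) ^ 2 * (1 / η * ‖E‖) := by gcongr
      _ = (i : ℝ) ^ 2 * ‖E‖ / η := by ring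
  refine ⟨fun C p hp hC => ?_, fun i hi => (hcheb i hi).trans ?_⟩
  · have hC0 : 0 ≤ C := (abs_nonneg _).trans (hC a ⟨le_rfl, hab.le⟩)
    obtain ⟨c, hc, hcC⟩ := Lanczos.exists_shiftedChebyshev_expansion hp hab hC
    rw [hc]
    calc _ ≤ ∑ i ∈ Finset.range k,
            |c i| * Lanczos.polyError hk A Q T (Lanczos.shiftedChebyshev a b i) :=
          Lanczos.polyError_sum_smul_le hk A Q T _ _ _
      _ ≤ ∑ _i ∈ Finset.range k, 2 * C * ((k : ℝ) ^ 2 * ‖E‖ / η) := by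
          -- the crude bound `i ^ 2 ≤ k ^ 2` in each of the `k` terms gives the factor `k ^ 3`
          refine Finset.sum_le_sum fun i hi => ?_
          have hik := Finset.mem_range.mp hi
          refine mul_le_mul (hcC i hi) ((hcheb i hik).trans ?_) (norm_nonneg _) (by positivity)
          gcongr
      _ = 2 * C * (k : ℝ) ^ 3 * ‖E‖ / η := by
          rw [Finset.sum_const, Finset.card_range, nsmul_eq_mul]
          ring
  · gcongr
    nlinarith [sq_nonneg (i : ℝ)]
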